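/- Let $m\ge 2$ terminals be given, and let $Y_{i,j}$ ($1\le i\ne j\le m$) be jointly distributed random variables with finite alphabets such that the network is pair-wise independent, i.e. for all $i\neq j$ $$I\bigl(Y_{i,j},Y_{j,i};\{Y_{k,l}: k\ne l,\ (k,l)\neq (i,j),(j,i)\}\bigr)=0 .$$ Terminal $i$ observes $n$ independent repetitions $X_i^n$ of $X_i=(Y_{i,j})_{j\ne i}$; all entropies use one fixed logarithm base. The terminals may privately randomize, with finite-valued random variables $U_1,\dots,U_m$ that are mutually independent and independent of the observations, and may communicate over a noiseless public channel, interactively in finitely many time slots: the message sent in a slot (from a finite alphabet) is a function of $U_i$, $X_i^n$ and all earlier messages, where $i$ is the terminal assigned to that slot. Let $F$ denote all the messages together. For $A\subseteq\{1,\dots,m\}$ and $\varepsilon>0$, a function $K$ of $(U_1,\dots,U_m,X_1^n,\dots,X_m^n)$ with values in a finite set $\mathcal K$ is an $\varepsilon$-secret key for $A$ if (i) for each $i\in A$ there is a function $g_i$ with $\Pr[g_i(U_i,X_i^n,F)\ne K]\le\varepsilon$, (ii) $\frac1n I(K;F)\le\varepsilon$, and (iii) $\frac1n H(K)\ge\frac1n\log|\mathcal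 K|-\varepsilon$. A rate $R$ is achievable if for every $\varepsilon>0$ and all sufficiently large $n$ there is, with suitable randomization and communication, an $\varepsilon$-secret key $K$ for $A$ with $\frac1nH(K)\ge R-\varepsilon$. The secret key capacity $C_{SK}(A)$ is the supremum of the achievable rates. For $k\ge 2$ let $\mathcal B_k(A)$ be the set of all partitions $(B_1,\dots,B_k)$ of $\{1,\dots,m\}$ into $k$ blocks each of which intersects $A$. Then, for every $A$ with $|A|\ge 2$, $$C_{SK}(A)\le \min_{2\le k\le |A|}\frac{1}{k-1}I'_k(A),\qquad I'_k(A)=\min_{(B_1,\dots,B_k)\in\mathcal B_k(A)}\ \sum_{l<r}\ \sum_{i\in B_l,\ j\in B_r} I(Y_{i,j};Y_{j,i}).$$ -/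

import Mathlib

open MeasureTheory

noncomputable section

namespace SecretKey

/-- Shannon entropy (in nats) of a random variable `X` with finite alphabet `S`. -/
def entropy {Ω S : Type*} [MeasurableSpace Ω] [Fintype S] (μ : Measure Ω) (X : Ω → S) : ℝ :=
  ∑ x : S, Real.negMulLog (μ.real (X ⁻¹' {x}))

/-- Mutual information `I(X;Y) = H(X) + H(Y) - H(X,Y)` of finite-valued random variables. -/
def mutualInfo {Ω S T : Type*} [MeasurableSpace Ω] [Fintype S] [Fintype T]
    (μ : Measure Ω) (X : Ω → S) (Y : Ω → T) : ℝ :=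
  entropy μ X + entropy μ Y - entropy μ (fun ω => (X ω, Y ω))

section Model

variable {m : ℕ} {𝒳 : Fin m → Type*}

/-- What happens in `n` repetitions of the source: the `n` source symbols `(X_1,...,X_m)`,
and the private randomness of each terminal (terminal `i` draws from `Fin (u i)`). -/
abbrev Outcome (𝒳 : Fin m → Type*) (n : ℕ) (u : Fin m → ℕ) : Type _ :=
  (Fin n → ∀ i, 𝒳 i) × (∀ i, Fin (u i))

/-- The law of the outcome: the source symbols are i.i.d. with joint law `P`, and the private
random variables have laws `ν i`, are mutually independent and independent of the source. -/
def outcomeLaw [∀ i, MeasurableSpace (𝒳 i)] (P : Measure (∀ i, 𝒳 i)) (n : ℕ)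
    {u : Fin m → ℕ} (ν : ∀ i, Measure (Fin (u i))) : Measure (Outcome 𝒳 n u) :=
  (Measure.pi fun _ : Fin n => P).prod (Measure.pi ν)

/-- The private data of terminal `i`: its randomness and its observations `X_i^n`. -/
def localView {n : ℕ} {u : Fin m → ℕ} (i : Fin m) (s : Outcome 𝒳 n u) :
    Fin (u i) × (Fin n → 𝒳 i) :=
  (s.2 i, fun t => s.1 t i)

/-- Interactive public communication in `r` time slots: the message `F t` of slot `t` is
a function of the private data of the terminal `speaker t` and of all earlier messages. -/
def IsPublicCommunication {n : ℕ} {u : Fin m → ℕ} {r b : ℕ} (speaker : Fin r → Fin m)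
    (F : Fin r → Outcome 𝒳 n u → Fin b) : Prop :=
  ∀ t : Fin r, ∃ f : Fin (u (speaker t)) × (Fin n → 𝒳 (speaker t)) →
      ({q : Fin r // q < t} → Fin b) → Fin b,
    ∀ s, F t s = f (localView (speaker t) s) (fun q => F q s)

/-- `K` is an `ε`-secret key for the group `A`, obtained with the public transmissions `F`. -/
structure IsSecretKey [∀ i, MeasurableSpace (𝒳 i)] {n : ℕ} {u : Fin m → ℕ}
    (μ : Measure (Outcome 𝒳 n u)) (A : Finset (Fin m)) {r b N : ℕ}
    (F : Fin r → Outcome 𝒳 n u → Fin b) (K : Outcome 𝒳 n u → Fin N) (ε : ℝ) : Prop where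
  /-- every terminal of `A` recovers the key from its data and the public transmissions -/
  recoverable : ∀ i ∈ A, ∃ g : Fin (u i) × (Fin n → 𝒳 i) → (Fin r → Fin b) → Fin N,
    μ.real {s | g (localView i s) (fun t => F t s) ≠ K s} ≤ ε
  /-- the key is nearly independent of the public transmissions -/
  secret : mutualInfo μ K (fun s t => F t s) ≤ n * ε
  /-- the key is nearly uniform on its alphabet -/
  uniform : Real.log N - n * ε ≤ entropy μ K

/-- `R` is an achievable secret key rate for the group `A`. -/
def IsAchievable [∀ i, MeasurableSpace (𝒳 i)] (P : Measure (∀ i, 𝒳 i)) (A : Finset (Fin m))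
    (R : ℝ) : Prop :=
  ∀ ε : ℝ, 0 < ε → ∃ n₀ : ℕ, ∀ n : ℕ, n₀ ≤ n →
    ∃ (u : Fin m → ℕ) (ν : ∀ i, Measure (Fin (u i))) (r b N : ℕ) (speaker : Fin r → Fin m)
      (F : Fin r → Outcome 𝒳 n u → Fin b) (K : Outcome 𝒳 n u → Fin N),
      (∀ i, IsProbabilityMeasure (ν i)) ∧
      IsPublicCommunication speaker F ∧
      IsSecretKey (outcomeLaw P n ν) A F K ε ∧
      R - ε ≤ entropy (outcomeLaw P n ν) K / n

/-- The secret key capacity `C_SK(A)` of the source with joint law `P`: the supremum, in the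
extended reals, of the achievable secret key rates. -/
def capacity [∀ i, MeasurableSpace (𝒳 i)] (P : Measure (∀ i, 𝒳 i)) (A : Finset (Fin m)) :
    EReal :=
  ⨆ (R : ℝ) (_ : IsAchievable P A R), (R : EReal)

/-- `(B_1,...,B_k)` is a partition of the set of terminals, every block of which meets `A`. -/
structure IsKPartition (A : Finset (Fin m)) {k : ℕ} (B : Fin k → Finset (Fin m)) : Prop where
  disjoint : ∀ l r, l ≠ r → Disjoint (B l) (B r)
  cover : ∀ i, ∃ l, i ∈ B l
  meets : ∀ l, (B l ∩ A).Nonempty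

end Model

section Pairwise

variable {m : ℕ} {𝒴 : Fin m → Fin m → Type*} {Ω : Type*} [MeasurableSpace Ω]

/-- Pair-wise independence: for `i ≠ j`, the pair `(Y_{i,j}, Y_{j,i})` has zero mutual
information with the family of all `Y_{k,l}`, `k ≠ l`, `(k,l) ≠ (i,j), (j,i)`.
(The values `Y i i` never play a role.) -/
def IsPairwiseIndependent [∀ i j, Fintype (𝒴 i j)] (μ : Measure Ω)
    (Y : ∀ i j, Ω → 𝒴 i j) : Prop :=
  ∀ i j, i ≠ j →
    mutualInfo μ (fun ω => (Y i j ω, Y j i ω))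
      (fun ω (p : {p : Fin m × Fin m // p.1 ≠ p.2 ∧ p ≠ (i, j) ∧ p ≠ (j, i)}) =>
        Y p.1.1 p.1.2 ω) = 0

/-- The joint law of `(X_1,...,X_m)`, where `X_i = (Y_{i,j})_{j ≠ i}`. -/
def networkLaw [∀ i j, MeasurableSpace (𝒴 i j)] (μ : Measure Ω) (Y : ∀ i j, Ω → 𝒴 i j) :
    Measure (∀ i, ∀ j : {j : Fin m // j ≠ i}, 𝒴 i j) :=
  μ.map fun ω i j => Y i j ω

/-- The sum of `I(Y_{i,j};Y_{j,i})` over `i ∈ B_l`, `j ∈ B_r`, `l < r`. -/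
def crossInfo [∀ i j, Fintype (𝒴 i j)] (μ : Measure Ω) (Y : ∀ i j, Ω → 𝒴 i j)
    {k : ℕ} (B : Fin k → Finset (Fin m)) : ℝ :=
  ∑ l : Fin k, ∑ r : Fin k with l < r, ∑ i ∈ B l, ∑ j ∈ B r, mutualInfo μ (Y i j) (Y j i)

/-- `I'_k(A)`: the minimum of `crossInfo` over the `k`-partitions whose blocks all meet `A`
(a finite set of partitions, nonempty if `1 ≤ k ≤ |A|`). -/
def minCrossInfo [∀ i j, Fintype (𝒴 i j)] (μ : Measure Ω) (Y : ∀ i j, Ω → 𝒴 i j)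
    (A : Finset (Fin m)) (k : ℕ) : ℝ :=
  sInf {v : ℝ | ∃ B : Fin k → Finset (Fin m), IsKPartition A B ∧ v = crossInfo μ Y B}

/-- The minimum of `I'_k(A) / (k - 1)` over `2 ≤ k ≤ |A|` (a nonempty range if `2 ≤ |A|`). -/
def partitionBound [∀ i j, Fintype (𝒴 i j)] (μ : Measure Ω) (Y : ∀ i j, Ω → 𝒴 i j)
    (A : Finset (Fin m)) : ℝ :=
  sInf {v : ℝ | ∃ k : ℕ, 2 ≤ k ∧ k ≤ A.card ∧ v = minCrossInfo μ Y A k / ((k : ℝ) - 1)}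

end Pairwise

end SecretKey

end

/-!
Call `∑ H(V_l) - H(V_1, ..., V_k)` the multi-information of the variables `V_l`, and let `V_l` be
the private data of all the terminals of the block `B_l`. A public message is a function of the
data of one block and of earlier messages, so conditioning on it does not increase the
multi-information; hence, given the whole communication `F`, the latter is at most its value for
the source, which is `n` times that of a single source symbol, as the private randomness is
independent. Conditioned on the key `K` as well, the multi-information is still nonnegative. Each
block contains a terminal of `A`, which nearly recovers `K` from `F`, so by the chain rule and
Fano's inequality this nonnegativity says that `(k - 1) H(K|F)` is at most the multi-information
given `F`, up to an error of order `ε n`. For a pair-wise independent network the single-letter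
multi-information is the sum of `I(Y_{i,j};Y_{j,i})` over the pairs across blocks: pairs inside a
block contribute the same to `∑ H(V_l)` as to the joint entropy.
-/

namespace SecretKey

section Entropy

theorem exists_eq_comp_of_factorsThrough {α β γ : Type*} [Nonempty α] {g : α → γ} {f : α → β}
    (h : g.FactorsThrough f) : ∃ e : β → γ, g = e ∘ f := by
  have : Nonempty γ := Nonempty.map g ‹_›
  exact (Function.factorsThrough_iff g).1 h

variable {Ω S T R : Type*} [MeasurableSpace Ω] [Fintype S] [Fintype T] [Fintype R]
  {μ : Measure Ω}

/-- The conditional entropy `H(X|Y) = H(X,Y) - H(Y)` of finite-valued random variables. -/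
noncomputable def condEntropy (μ : Measure Ω) (X : Ω → R) (Y : Ω → T) : ℝ :=
  entropy μ (fun ω => (X ω, Y ω)) - entropy μ Y

theorem mutualInfo_eq_entropy_sub_condEntropy (X : Ω → R) (Y : Ω → T) :
    mutualInfo μ X Y = entropy μ X - condEntropy μ X Y := by
  unfold mutualInfo condEntropy
  ring

theorem entropy_of_subsingleton [IsProbabilityMeasure μ] [Subsingleton R] (X : Ω → R) :
    entropy μ X = 0 := by
  refine Finset.sum_eq_zero fun x _ => ?_
  have : X ⁻¹' {x} = Set.univ := Set.eq_univ_of_forall fun ω => Subsingleton.elim _ _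
  simp [this]

theorem sum_negMulLog_le_sum_mul_neg_log {ι : Type*} (s : Finset ι) {p q : ι → ℝ}
    (hp : ∀ i ∈ s, 0 ≤ p i) (hq : ∀ i ∈ s, 0 ≤ q i) (hpq : ∀ i ∈ s, q i = 0 → p i = 0)
    (hsum : ∑ i ∈ s, q i ≤ ∑ i ∈ s, p i) :
    ∑ i ∈ s, Real.negMulLog (p i) ≤ ∑ i ∈ s, p i * -Real.log (q i) := by
  have hterm : ∀ i ∈ s, Real.negMulLog (p i) - p i * -Real.log (q i) ≤ q i - p i := by
    intro i hi
    rcases (hp i hi).eq_or_lt' with h0 | hpos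
    · simpa [h0] using hq i hi
    · have hqpos : 0 < q i := (hq i hi).lt_of_ne' fun h => hpos.ne' (hpq i hi h)
      calc Real.negMulLog (p i) - p i * -Real.log (q i)
          = p i * Real.log (q i / p i) := by
            rw [Real.log_div hqpos.ne' hpos.ne', Real.negMulLog]
            ring
        _ ≤ p i * (q i / p i - 1) := by
            gcongr
            exact Real.log_le_sub_one_of_pos (div_pos hqpos hpos)
        _ = q i - p i := by field_simp
  have h := Finset.sum_le_sum hterm
  simp only [Finset.sum_sub_distrib] at h
  linarith

variable [MeasurableSpace S] [MeasurableSingletonClass S]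
  [MeasurableSpace T] [MeasurableSingletonClass T]

theorem sum_measureReal_preimage_mul_comp [IsFiniteMeasure μ] {Y : Ω → T} (hY : Measurable Y)
    (f : T → R) (h : R → ℝ) :
    ∑ y, μ.real (Y ⁻¹' {y}) * h (f y) = ∑ x, μ.real ((f ∘ Y) ⁻¹' {x}) * h x := by
  classical
  rw [← Finset.sum_fiberwise Finset.univ f]
  refine Finset.sum_congr rfl fun x _ => ?_
  calc ∑ y with f y = x, μ.real (Y ⁻¹' {y}) * h (f y)
      = (∑ y with f y = x, μ.real (Y ⁻¹' {y})) * h x := by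
        rw [Finset.sum_mul]
        exact Finset.sum_congr rfl fun y hy => by rw [(Finset.mem_filter.1 hy).2]
    _ = μ.real ((f ∘ Y) ⁻¹' {x}) * h x := by
        rw [sum_measureReal_preimage_singleton _ fun y _ => hY (measurableSet_singleton y)]
        congr 2
        ext
        simp

theorem sum_mul_neg_log_comp [IsFiniteMeasure μ] {Y : Ω → T} (hY : Measurable Y) (f : T → R) :
    ∑ y, μ.real (Y ⁻¹' {y}) * -Real.log (μ.real ((f ∘ Y) ⁻¹' {f y})) = entropy μ (f ∘ Y) := by
  rw [sum_measureReal_preimage_mul_comp hY f fun x => -Real.log (μ.real ((f ∘ Y) ⁻¹' {x}))]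
  simp [entropy, Real.negMulLog]

theorem sum_measureReal_preimage_singleton_eq_one [IsProbabilityMeasure μ] {Y : Ω → T}
    (hY : Measurable Y) : ∑ y, μ.real (Y ⁻¹' {y}) = 1 := by
  rw [sum_measureReal_preimage_singleton _ fun y _ => hY (measurableSet_singleton y)]
  simp

theorem entropy_comp_measurePreserving {Ω' : Type*} [MeasurableSpace Ω'] {μ' : Measure Ω'}
    {f : Ω → Ω'} (hf : MeasurePreserving f μ μ') {X : Ω' → S}
    (hX : Measurable X := by fun_prop) : entropy μ (fun ω => X (f ω)) = entropy μ' X :=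
  Finset.sum_congr rfl fun x _ =>
    congrArg _ (hf.measureReal_preimage (hX (measurableSet_singleton x)).nullMeasurableSet)

variable [IsProbabilityMeasure μ]

theorem entropy_le_of_factorsThrough {X : Ω → R} {Y : Ω → T} (h : X.FactorsThrough Y)
    (hY : Measurable Y := by fun_prop) : entropy μ X ≤ entropy μ Y := by
  have := μ.nonempty_of_neZero
  obtain ⟨f, rfl⟩ := exists_eq_comp_of_factorsThrough h
  rw [← sum_mul_neg_log_comp hY f, entropy]
  refine Finset.sum_le_sum fun y _ => ?_
  rw [Real.negMulLog, neg_mul_comm]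
  rcases (measureReal_nonneg (μ := μ) (s := Y ⁻¹' {y})).eq_or_lt' with h0 | hpos
  · simp [h0]
  · have hle : μ.real (Y ⁻¹' {y}) ≤ μ.real ((f ∘ Y) ⁻¹' {f y}) :=
      measureReal_mono fun ω hω => congrArg f hω
    gcongr

theorem entropy_congr {X : Ω → S} {Y : Ω → T} (h : X.FactorsThrough Y) (h' : Y.FactorsThrough X)
    (hX : Measurable X := by fun_prop) (hY : Measurable Y := by fun_prop) :
    entropy μ X = entropy μ Y :=
  (entropy_le_of_factorsThrough h).antisymm (entropy_le_of_factorsThrough h')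

end Entropy

section CondEntropy

variable {Ω S T R : Type*} [MeasurableSpace Ω] {μ : Measure Ω} [IsProbabilityMeasure μ]

theorem measureReal_preimage_prodMk_eq_zero (X : Ω → S) {W : Ω → T} {z : S × T}
    (h : μ.real (W ⁻¹' {z.2}) = 0) : μ.real ((fun ω => (X ω, W ω)) ⁻¹' {z}) = 0 :=
  measureReal_mono_null (fun _ hω => congrArg Prod.snd hω) h

variable [Fintype S] [MeasurableSpace S] [MeasurableSingletonClass S]

theorem sum_measureReal_preimage_prodMk {X : Ω → S} (hX : Measurable X) (W : Ω → T) (w : T) :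
    ∑ x, μ.real ((fun ω => (X ω, W ω)) ⁻¹' {(x, w)}) = μ.real (W ⁻¹' {w}) := by
  calc ∑ x, μ.real ((fun ω => (X ω, W ω)) ⁻¹' {(x, w)})
      = ∑ x, (μ.restrict (W ⁻¹' {w})).real (X ⁻¹' {x}) := by
        refine Finset.sum_congr rfl fun x _ => ?_
        rw [measureReal_restrict_apply (hX (measurableSet_singleton x)),
          ← Set.singleton_prod_singleton, Set.mk_preimage_prod]
    _ = μ.real (W ⁻¹' {w}) := by
        rw [sum_measureReal_preimage_singleton _ fun x _ => hX (measurableSet_singleton x)]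
        simp

variable [Fintype T] [MeasurableSpace T] [MeasurableSingletonClass T]
  [Fintype R] [MeasurableSpace R] [MeasurableSingletonClass R]

theorem condEntropy_le_sum_mul_neg_log {X : Ω → S} {W : Ω → T} {q : S → T → ℝ}
    (hq : ∀ x w, 0 ≤ q x w) (hq1 : ∀ w, ∑ x, q x w ≤ 1)
    (hpq : ∀ z : S × T, q z.1 z.2 = 0 → μ.real ((fun ω => (X ω, W ω)) ⁻¹' {z}) = 0)
    (hX : Measurable X := by fun_prop) (hW : Measurable W := by fun_prop) :
    condEntropy μ X W ≤
      ∑ z : S × T, μ.real ((fun ω => (X ω, W ω)) ⁻¹' {z}) * -Real.log (q z.1 z.2) := by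
  have hXW : Measurable fun ω => (X ω, W ω) := by fun_prop
  set p := fun z => μ.real ((fun ω => (X ω, W ω)) ⁻¹' {z})
  set pW := fun w => μ.real (W ⁻¹' {w})
  have hp_zero : ∀ z, pW z.2 = 0 → p z = 0 := fun _ => measureReal_preimage_prodMk_eq_zero X
  have hsum : ∑ z : S × T, pW z.2 * q z.1 z.2 ≤ ∑ z, p z := by
    rw [sum_measureReal_preimage_singleton_eq_one hXW,
      ← sum_measureReal_preimage_singleton_eq_one (μ := μ) hW, Fintype.sum_prod_type_right]
    refine Finset.sum_le_sum fun w _ => ?_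
    calc ∑ x, pW w * q x w = pW w * ∑ x, q x w := (Finset.mul_sum ..).symm
      _ ≤ pW w := mul_le_of_le_one_right measureReal_nonneg (hq1 w)
  have hgibbs : entropy μ (fun ω => (X ω, W ω)) ≤
      ∑ z, p z * -Real.log (pW z.2 * q z.1 z.2) :=
    sum_negMulLog_le_sum_mul_neg_log Finset.univ (fun _ _ => measureReal_nonneg)
      (fun z _ => mul_nonneg measureReal_nonneg (hq _ _))
      (fun z _ h => (mul_eq_zero.1 h).elim (hp_zero z) (hpq z)) hsum
  have hsplit : ∀ z, p z * -Real.log (pW z.2 * q z.1 z.2) =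
      p z * -Real.log (pW z.2) + p z * -Real.log (q z.1 z.2) := by
    intro z
    by_cases hz : p z = 0
    · simp [hz]
    · rw [Real.log_mul (mt (hp_zero z) hz) (mt (hpq z) hz)]
      ring
  have hW_sum : ∑ z, p z * -Real.log (pW z.2) = entropy μ W :=
    sum_mul_neg_log_comp hXW Prod.snd
  simp only [hsplit, Finset.sum_add_distrib, hW_sum] at hgibbs
  exact sub_le_iff_le_add'.2 hgibbs

theorem condEntropy_eq_sum {X : Ω → S} {W : Ω → T}
    (hX : Measurable X := by fun_prop) (hW : Measurable W := by fun_prop) :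
    condEntropy μ X W = ∑ z : S × T, μ.real ((fun ω => (X ω, W ω)) ⁻¹' {z}) *
      -Real.log (μ.real ((fun ω => (X ω, W ω)) ⁻¹' {z}) / μ.real (W ⁻¹' {z.2})) := by
  have hW_sum : ∑ z : S × T, μ.real ((fun ω => (X ω, W ω)) ⁻¹' {z}) *
      -Real.log (μ.real (W ⁻¹' {z.2})) = entropy μ W :=
    sum_mul_neg_log_comp (hX.prodMk hW) Prod.snd
  rw [condEntropy, ← hW_sum, entropy, ← Finset.sum_sub_distrib]
  refine Finset.sum_congr rfl fun z _ => ?_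
  by_cases hz : μ.real ((fun ω => (X ω, W ω)) ⁻¹' {z}) = 0
  · simp [hz]
  · have hz' : μ.real (W ⁻¹' {z.2}) ≠ 0 :=
      mt (measureReal_preimage_prodMk_eq_zero X) hz
    rw [Real.log_div hz hz', Real.negMulLog]
    ring

theorem condEntropy_le_condEntropy_of_factorsThrough {X : Ω → S} {W : Ω → T} {Z : Ω → R}
    (h : Z.FactorsThrough W) (hX : Measurable X := by fun_prop)
    (hW : Measurable W := by fun_prop) (hZ : Measurable Z := by fun_prop) :
    condEntropy μ X W ≤ condEntropy μ X Z := by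
  have := μ.nonempty_of_neZero
  obtain ⟨f, rfl⟩ := exists_eq_comp_of_factorsThrough h
  set p := fun z => μ.real ((fun ω => (X ω, (f ∘ W) ω)) ⁻¹' {z})
  set pZ := fun r => μ.real ((f ∘ W) ⁻¹' {r})
  have hpq : ∀ z : S × T, p (z.1, f z.2) / pZ (f z.2) = 0 →
      μ.real ((fun ω => (X ω, W ω)) ⁻¹' {z}) = 0 := by
    rintro ⟨x, w⟩ h0
    have hp0 : p (x, f w) = 0 := (div_eq_zero_iff.1 h0).elim id
      fun h => measureReal_preimage_prodMk_eq_zero X (z := (x, f w)) h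
    exact measureReal_mono_null (fun ω hω => by simp_all) hp0
  calc condEntropy μ X W
      ≤ ∑ z : S × T, μ.real ((fun ω => (X ω, W ω)) ⁻¹' {z}) *
          -Real.log (p (z.1, f z.2) / pZ (f z.2)) := by
        refine condEntropy_le_sum_mul_neg_log (q := fun x w => p (x, f w) / pZ (f w))
          (fun x w => div_nonneg measureReal_nonneg measureReal_nonneg) (fun w => ?_) hpq
        rw [← Finset.sum_div, sum_measureReal_preimage_prodMk hX]
        exact div_self_le_one _
    _ = condEntropy μ X (f ∘ W) := by
        rw [condEntropy_eq_sum]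
        exact sum_measureReal_preimage_mul_comp (hX.prodMk hW) (Prod.map id f)
          fun z => -Real.log (p z / pZ z.2)

theorem condEntropy_of_subsingleton [Subsingleton T] {X : Ω → S} (W : Ω → T)
    (hX : Measurable X := by fun_prop) : condEntropy μ X W = entropy μ X := by
  rw [condEntropy, entropy_of_subsingleton W, sub_zero]
  exact entropy_congr (fun ω ω' e => by simp [e, Subsingleton.elim (W ω) (W ω')])
    (fun ω ω' e => by simp_all)

end CondEntropy

section Fano

variable {Ω T κ : Type*} [MeasurableSpace Ω] {μ : Measure Ω} [IsProbabilityMeasure μ]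
  [Fintype T] [MeasurableSpace T] [MeasurableSingletonClass T]
  [Fintype κ] [MeasurableSpace κ] [MeasurableSingletonClass κ]

theorem fano {K : Ω → κ} {W : Ω → T} (g : T → κ) {ε : ℝ}
    (hε : μ.real {ω | g (W ω) ≠ K ω} ≤ ε) (hK : Measurable K := by fun_prop)
    (hW : Measurable W := by fun_prop) :
    condEntropy μ K W ≤ Real.log 2 + ε * Real.log (Fintype.card κ) := by
  classical
  obtain ⟨ω₀⟩ := μ.nonempty_of_neZero
  have hN : (0 : ℝ) < Fintype.card κ := by exact_mod_cast Fintype.card_pos_iff.2 ⟨K ω₀⟩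
  -- The half-and-half mixture of the guess `g w` and the uniform law on `κ`.
  set q : κ → T → ℝ := fun x w => (if g w = x then 2⁻¹ else 0) + (2 * Fintype.card κ : ℝ)⁻¹ with hq
  have hq_pos : ∀ x w, 0 < q x w := fun x w => by
    simp only [hq]
    split_ifs <;> positivity
  have hq_sum : ∀ w, ∑ x, q x w ≤ 1 := fun w => by
    simp only [hq, Finset.sum_add_distrib, Finset.sum_ite_eq, Finset.mem_univ, if_true,
      Finset.sum_const, Finset.card_univ, nsmul_eq_mul]
    field_simp
    norm_num
  have hq_log : ∀ x w, -Real.log (q x w) ≤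
      Real.log 2 + (if g w ≠ x then 1 else 0) * Real.log (Fintype.card κ) := by
    intro x w
    rw [← Real.log_inv]
    split_ifs with h
    · rw [one_mul, ← Real.log_mul two_ne_zero hN.ne']
      gcongr
      exact inv_le_of_inv_le₀ (by positivity) (le_add_of_nonneg_left (by positivity))
    · rw [zero_mul, add_zero]
      gcongr
      refine inv_le_of_inv_le₀ two_pos ?_
      simp only [hq, if_pos (not_not.1 h)]
      exact le_add_of_nonneg_right (by positivity)
  have herr : ∑ z : κ × T, μ.real ((fun ω => (K ω, W ω)) ⁻¹' {z}) *
      (if g z.2 ≠ z.1 then 1 else 0) = μ.real {ω | g (W ω) ≠ K ω} := by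
    simp only [mul_ite, mul_one, mul_zero, ← Finset.sum_filter]
    rw [sum_measureReal_preimage_singleton _ fun z _ =>
      (hK.prodMk hW) (measurableSet_singleton z)]
    congr 1
    ext
    simp
  calc condEntropy μ K W
      ≤ ∑ z : κ × T, μ.real ((fun ω => (K ω, W ω)) ⁻¹' {z}) * -Real.log (q z.1 z.2) :=
        condEntropy_le_sum_mul_neg_log (fun x w => (hq_pos x w).le) hq_sum
          fun z h => ((hq_pos _ _).ne' h).elim
    _ ≤ ∑ z : κ × T, μ.real ((fun ω => (K ω, W ω)) ⁻¹' {z}) *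
          (Real.log 2 + (if g z.2 ≠ z.1 then 1 else 0) * Real.log (Fintype.card κ)) := by
        gcongr
        exact hq_log _ _
    _ = Real.log 2 + μ.real {ω | g (W ω) ≠ K ω} * Real.log (Fintype.card κ) := by
        rw [← herr]
        simp only [mul_add, Finset.sum_add_distrib, ← Finset.sum_mul, ← mul_assoc,
          sum_measureReal_preimage_singleton_eq_one (hK.prodMk hW), one_mul]
    _ ≤ Real.log 2 + ε * Real.log (Fintype.card κ) := by
        gcongr

end Fano

section Families

variable {Ω ι S T R : Type*} {A B : ι → Type*} [MeasurableSpace Ω] {μ : Measure Ω}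
  [IsProbabilityMeasure μ] [Fintype R]
  [Fintype S] [MeasurableSpace S] [MeasurableSingletonClass S]
  [Fintype T] [MeasurableSpace T] [MeasurableSingletonClass T]
  [∀ i, Fintype (A i)] [∀ i, MeasurableSpace (A i)] [∀ i, MeasurableSingletonClass (A i)]
  [∀ i, Fintype (B i)] [∀ i, MeasurableSpace (B i)] [∀ i, MeasurableSingletonClass (B i)]

theorem condEntropy_le_of_factorsThrough {X : Ω → R} {Y : Ω → S} {W : Ω → T}
    (h : X.FactorsThrough fun ω => (Y ω, W ω)) (hY : Measurable Y := by fun_prop)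
    (hW : Measurable W := by fun_prop) : condEntropy μ X W ≤ condEntropy μ Y W :=
  have hle : entropy μ (fun ω => (X ω, W ω)) ≤ entropy μ (fun ω => (Y ω, W ω)) :=
    entropy_le_of_factorsThrough fun _ _ e => Prod.ext (h e) (Prod.ext_iff.1 e).2
  sub_le_sub_right hle _

theorem entropy_le_add {X : Ω → S} {Y : Ω → T} {Z : Ω → R}
    (h : Z.FactorsThrough fun ω => (X ω, Y ω)) (hX : Measurable X := by fun_prop)
    (hY : Measurable Y := by fun_prop) : entropy μ Z ≤ entropy μ X + entropy μ Y := by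
  calc entropy μ Z ≤ entropy μ (fun ω => (X ω, Y ω)) := entropy_le_of_factorsThrough h
    _ = condEntropy μ X Y + entropy μ Y := (sub_add_cancel _ _).symm
    _ ≤ condEntropy μ X (fun _ => ()) + entropy μ Y := by
      gcongr
      exact condEntropy_le_condEntropy_of_factorsThrough fun _ _ _ => rfl
    _ = entropy μ X + entropy μ Y := by rw [condEntropy_of_subsingleton]

theorem condEntropy_prodMk [MeasurableSpace R] [MeasurableSingletonClass R] {X : Ω → S} {Y : Ω → R}
    {W : Ω → T} (hX : Measurable X := by fun_prop) (hY : Measurable Y := by fun_prop)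
    (hW : Measurable W := by fun_prop) :
    condEntropy μ (fun ω => (X ω, Y ω)) W =
      condEntropy μ X (fun ω => (Y ω, W ω)) + condEntropy μ Y W := by
  have hassoc : entropy μ (fun ω => ((X ω, Y ω), W ω)) = entropy μ (fun ω => (X ω, Y ω, W ω)) :=
    entropy_congr (fun ω ω' e => by simp_all) (fun ω ω' e => by simp_all)
  simp only [condEntropy, hassoc]
  ring

theorem condEntropy_pi_finset_le_sum [DecidableEq ι] {X : ∀ i, Ω → A i} {W : Ω → T} (s : Finset ι)
    (hX : ∀ i, Measurable (X i) := by fun_prop) (hW : Measurable W := by fun_prop) :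
    condEntropy μ (fun ω (i : s) => X i ω) W ≤ ∑ i ∈ s, condEntropy μ (X i) W := by
  induction s using Finset.induction_on with
  | empty =>
    exact (sub_nonpos.2 (entropy_le_of_factorsThrough fun _ _ e =>
      Prod.ext (Subsingleton.elim _ _) e)).trans_eq Finset.sum_empty.symm
  | insert a s ha ih =>
    calc condEntropy μ (fun ω (i : (insert a s : Finset ι)) => X i ω) W
        ≤ condEntropy μ (fun ω => (X a ω, fun i : s => X i ω)) W :=
          condEntropy_le_of_factorsThrough fun ω ω' e => by
            simp_all [funext_iff]
      _ = condEntropy μ (X a) (fun ω => (fun i : s => X i ω, W ω)) +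
            condEntropy μ (fun ω (i : s) => X i ω) W := condEntropy_prodMk
      _ ≤ condEntropy μ (X a) W + ∑ i ∈ s, condEntropy μ (X i) W := by
          gcongr
          exact condEntropy_le_condEntropy_of_factorsThrough fun ω ω' e => congrArg Prod.snd e
      _ = ∑ i ∈ insert a s, condEntropy μ (X i) W := by rw [Finset.sum_insert ha]

theorem condEntropy_le_sum {X : ∀ i, Ω → A i} {W : Ω → T} {Z : Ω → R} {s : Finset ι}
    (h : Z.FactorsThrough fun ω (i : s) => X i ω)
    (hX : ∀ i, Measurable (X i) := by fun_prop) (hW : Measurable W := by fun_prop) :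
    condEntropy μ Z W ≤ ∑ i ∈ s, condEntropy μ (X i) W := by
  classical
  exact (condEntropy_le_of_factorsThrough fun _ _ e => h (congrArg Prod.fst e)).trans
    (condEntropy_pi_finset_le_sum s)

theorem entropy_le_sum {X : ∀ i, Ω → A i} {Z : Ω → R} {s : Finset ι}
    (h : Z.FactorsThrough fun ω (i : s) => X i ω)
    (hX : ∀ i, Measurable (X i) := by fun_prop) : entropy μ Z ≤ ∑ i ∈ s, entropy μ (X i) := by
  classical
  calc entropy μ Z ≤ entropy μ (fun ω (i : s) => X i ω) := entropy_le_of_factorsThrough h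
    _ = condEntropy μ (fun ω (i : s) => X i ω) (fun _ => ()) :=
      (condEntropy_of_subsingleton _).symm
    _ ≤ ∑ i ∈ s, condEntropy μ (X i) (fun _ => ()) := condEntropy_pi_finset_le_sum s
    _ = ∑ i ∈ s, entropy μ (X i) := Finset.sum_congr rfl fun i _ => condEntropy_of_subsingleton _

theorem sum_entropy_le_of_mutualInfo_eq_zero [MeasurableSpace R] [MeasurableSingletonClass R]
    {Q : ∀ i, Ω → A i} {W : ∀ i, Ω → B i} {Z : Ω → R} (s : Finset ι)
    (hQW : ∀ i ∈ s, ∀ j ∈ s, j ≠ i → (Q j).FactorsThrough (W i))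
    (hI : ∀ i ∈ s, mutualInfo μ (Q i) (W i) = 0) (hQZ : ∀ i ∈ s, (Q i).FactorsThrough Z)
    (hQ : ∀ i, Measurable (Q i) := by fun_prop) (hW : ∀ i, Measurable (W i) := by fun_prop)
    (hZ : Measurable Z := by fun_prop) :
    ∑ i ∈ s, entropy μ (Q i) ≤ entropy μ Z := by
  classical
  suffices h : ∑ i ∈ s, entropy μ (Q i) ≤ entropy μ (fun ω (i : s) => Q i ω) from
    h.trans (entropy_le_of_factorsThrough fun _ _ e => funext fun i => hQZ i i.2 e)
  clear hQZ
  induction s using Finset.induction_on with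
  | empty => simp [entropy_of_subsingleton]
  | insert a s ha ih =>
    have hle : ∑ i ∈ s, entropy μ (Q i) ≤ entropy μ (fun ω (i : s) => Q i ω) :=
      ih (fun i hi j hj => hQW i (Finset.mem_insert_of_mem hi) j (Finset.mem_insert_of_mem hj))
        fun i hi => hI i (Finset.mem_insert_of_mem hi)
    have ha_eq : entropy μ (Q a) = condEntropy μ (Q a) (W a) := by
      rw [← sub_eq_zero, ← mutualInfo_eq_entropy_sub_condEntropy]
      exact hI a (Finset.mem_insert_self a s)
    calc ∑ i ∈ insert a s, entropy μ (Q i)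
        = condEntropy μ (Q a) (W a) + ∑ i ∈ s, entropy μ (Q i) := by
          rw [Finset.sum_insert ha, ha_eq]
      _ ≤ condEntropy μ (Q a) (fun ω (i : s) => Q i ω) + entropy μ (fun ω (i : s) => Q i ω) := by
          gcongr
          refine condEntropy_le_condEntropy_of_factorsThrough fun _ _ e => funext fun i => ?_
          exact hQW a (Finset.mem_insert_self a s) i (Finset.mem_insert_of_mem i.2)
            (ne_of_mem_of_not_mem i.2 ha) e
      _ = entropy μ (fun ω => (Q a ω, fun i : s => Q i ω)) := sub_add_cancel _ _
      _ ≤ entropy μ (fun ω (i : (insert a s : Finset ι)) => Q i ω) :=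
          entropy_le_of_factorsThrough fun ω ω' e => by
            simp_all [funext_iff]

theorem entropy_prodMk_of_indepFun {X : Ω → S} {Y : Ω → T} (h : ProbabilityTheory.IndepFun X Y μ)
    (hX : Measurable X := by fun_prop) (hY : Measurable Y := by fun_prop) :
    entropy μ (fun ω => (X ω, Y ω)) = entropy μ X + entropy μ Y := by
  have hXY : Measurable fun ω => (X ω, Y ω) := by fun_prop
  have hprod : ∀ z : S × T, μ.real ((fun ω => (X ω, Y ω)) ⁻¹' {z}) =
      μ.real (X ⁻¹' {z.1}) * μ.real (Y ⁻¹' {z.2}) := by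
    rintro ⟨x, y⟩
    rw [← Set.singleton_prod_singleton, Set.mk_preimage_prod]
    simpa [measureReal_def] using congrArg ENNReal.toReal
      (h.measure_inter_preimage_eq_mul {x} {y} (measurableSet_singleton x)
        (measurableSet_singleton y))
  have hX_sum : ∑ z : S × T, _ * -Real.log (μ.real (X ⁻¹' {z.1})) = entropy μ X :=
    sum_mul_neg_log_comp hXY Prod.fst
  have hY_sum : ∑ z : S × T, _ * -Real.log (μ.real (Y ⁻¹' {z.2})) = entropy μ Y :=
    sum_mul_neg_log_comp hXY Prod.snd
  rw [← hX_sum, ← hY_sum, ← Finset.sum_add_distrib, entropy]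
  refine Finset.sum_congr rfl fun z _ => ?_
  by_cases hz : μ.real ((fun ω => (X ω, Y ω)) ⁻¹' {z}) = 0
  · simp [hz]
  · have hz' := hprod z ▸ hz
    rw [Real.negMulLog, neg_mul_comm, ← mul_add, hprod z,
      Real.log_mul (left_ne_zero_of_mul hz') (right_ne_zero_of_mul hz'), neg_add]

theorem entropy_pi_of_iIndepFun [Fintype ι] [DecidableEq ι] {X : ∀ i, Ω → A i}
    (h : ProbabilityTheory.iIndepFun X μ) (hX : ∀ i, Measurable (X i) := by fun_prop) :
    entropy μ (fun ω i => X i ω) = ∑ i, entropy μ (X i) := by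
  have hX_pi : Measurable fun ω i => X i ω := by fun_prop
  have hprod : ∀ x : ∀ i, A i, μ.real ((fun ω i => X i ω) ⁻¹' {x}) =
      ∏ i, μ.real (X i ⁻¹' {x i}) := by
    intro x
    have hx : (fun ω i => X i ω) ⁻¹' {x} = ⋂ i ∈ Finset.univ, X i ⁻¹' {x i} := by
      ext
      simp [funext_iff]
    rw [hx, measureReal_def, h.measure_inter_preimage_eq_mul _
      fun i _ => measurableSet_singleton (x i), ENNReal.toReal_prod]
    rfl
  have hsum : ∀ i, ∑ x : ∀ i, A i, _ * -Real.log (μ.real (X i ⁻¹' {x i})) = entropy μ (X i) :=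
    fun i => sum_mul_neg_log_comp hX_pi fun x => x i
  rw [← Finset.sum_congr rfl fun i _ => hsum i, Finset.sum_comm, entropy]
  refine Finset.sum_congr rfl fun x _ => ?_
  by_cases hx : μ.real ((fun ω i => X i ω) ⁻¹' {x}) = 0
  · simp [hx]
  · rw [← Finset.mul_sum, Finset.sum_neg_distrib, Real.negMulLog, neg_mul_comm,
      ← Real.log_prod (Finset.prod_ne_zero_iff.1 (hprod x ▸ hx)), hprod x]

end Families

section MultiInfo

variable {Ω ι κ T T' β : Type*} {S : ι → Type*} [MeasurableSpace Ω] [Fintype ι] [DecidableEq ι]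
  [∀ l, Fintype (S l)] [Fintype T] [Fintype T']

/-- The multi-information (total correlation) `∑ H(V_l) - H((V_l)_l)` of a finite family of random
variables; it measures the correlation available for generating a key. -/
noncomputable def multiInfo (μ : Measure Ω) (V : ∀ l, Ω → S l) : ℝ :=
  ∑ l, entropy μ (V l) - entropy μ (fun ω l => V l ω)

/-- The conditional multi-information `∑ H(V_l|G) - H((V_l)_l|G)`: the correlation that is left
once `G` is public. -/
noncomputable def condMultiInfo (μ : Measure Ω) (V : ∀ l, Ω → S l) (G : Ω → T) : ℝ :=
  ∑ l, condEntropy μ (V l) G - condEntropy μ (fun ω l => V l ω) G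

variable [∀ l, MeasurableSpace (S l)] [∀ l, MeasurableSingletonClass (S l)]

theorem multiInfo_comp_measurePreserving {Ω' : Type*} [MeasurableSpace Ω'] {μ : Measure Ω}
    {μ' : Measure Ω'} {f : Ω → Ω'} (hf : MeasurePreserving f μ μ') {V : ∀ l, Ω' → S l}
    (hV : ∀ l, Measurable (V l) := by fun_prop) :
    multiInfo μ (fun l ω => V l (f ω)) = multiInfo μ' V := by
  simp only [multiInfo, entropy_comp_measurePreserving hf (hV _)]
  rw [entropy_comp_measurePreserving hf (X := fun ω l => V l ω)]

variable {μ : Measure Ω} [IsProbabilityMeasure μ]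
  [MeasurableSpace T] [MeasurableSingletonClass T]
  [MeasurableSpace T'] [MeasurableSingletonClass T']
  [Fintype κ] [MeasurableSpace κ] [MeasurableSingletonClass κ]
  [Fintype β] [MeasurableSpace β] [MeasurableSingletonClass β]
  {V : ∀ l, Ω → S l}

theorem condMultiInfo_of_subsingleton [Subsingleton T] (G : Ω → T)
    (hV : ∀ l, Measurable (V l) := by fun_prop) : condMultiInfo μ V G = multiInfo μ V := by
  unfold condMultiInfo multiInfo
  congr 1
  · exact Finset.sum_congr rfl fun l _ => condEntropy_of_subsingleton G
  · exact condEntropy_of_subsingleton G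

theorem condMultiInfo_nonneg (G : Ω → T) (hV : ∀ l, Measurable (V l) := by fun_prop)
    (hG : Measurable G := by fun_prop) : 0 ≤ condMultiInfo μ V G :=
  sub_nonneg.2 <| condEntropy_le_sum fun _ _ e =>
    funext fun l => congrFun e ⟨l, Finset.mem_univ l⟩

theorem condEntropy_eq_sub_of_factorsThrough {X : Ω → κ} {G : Ω → T} {G' : Ω → T'}
    (hG : G.FactorsThrough G') (hG' : G'.FactorsThrough fun ω => (X ω, G ω))
    (hX : Measurable X := by fun_prop) (hG_meas : Measurable G := by fun_prop)
    (hG'_meas : Measurable G' := by fun_prop) :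
    condEntropy μ X G' = condEntropy μ X G - (entropy μ G' - entropy μ G) := by
  have hpair : entropy μ (fun ω => (X ω, G' ω)) = entropy μ (fun ω => (X ω, G ω)) :=
    entropy_congr (fun _ _ e => Prod.ext (Prod.ext_iff.1 e).1 (hG' e))
      (fun _ _ e => Prod.ext (Prod.ext_iff.1 e).1 (hG (Prod.ext_iff.1 e).2))
  rw [condEntropy, condEntropy, hpair]
  ring

-- The conditional entropies of `V l₀` and of the whole family drop by the same amount
-- `H(G') - H(G)`; those of the other members can only decrease.
theorem condMultiInfo_le_of_message {G : Ω → T} {G' : Ω → T'} (l₀ : ι)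
    (hG : G.FactorsThrough G') (hG' : G'.FactorsThrough fun ω => (V l₀ ω, G ω))
    (hV : ∀ l, Measurable (V l) := by fun_prop) (hG_meas : Measurable G := by fun_prop)
    (hG'_meas : Measurable G' := by fun_prop) :
    condMultiInfo μ V G' ≤ condMultiInfo μ V G := by
  have hfamily : condEntropy μ (fun ω l => V l ω) G' =
      condEntropy μ (fun ω l => V l ω) G - (entropy μ G' - entropy μ G) :=
    condEntropy_eq_sub_of_factorsThrough hG fun ω ω' e =>
      hG' (Prod.ext (congrFun (Prod.ext_iff.1 e).1 l₀) (Prod.ext_iff.1 e).2)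
  have hterm : ∀ l, condEntropy μ (V l) G' + (if l = l₀ then entropy μ G' - entropy μ G else 0) ≤
      condEntropy μ (V l) G := by
    intro l
    split_ifs with hl
    · subst hl
      rw [condEntropy_eq_sub_of_factorsThrough hG hG', sub_add_cancel]
    · rw [add_zero]
      exact condEntropy_le_condEntropy_of_factorsThrough hG
  have hsum := Finset.sum_le_sum fun l (_ : l ∈ Finset.univ) => hterm l
  simp only [Finset.sum_add_distrib, Finset.sum_ite_eq', Finset.mem_univ, if_true] at hsum
  unfold condMultiInfo
  linarith

theorem condMultiInfo_communication_le {r : ℕ} {F : Fin r → Ω → β}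
    (hF : ∀ t, ∃ l, (F t).FactorsThrough fun ω => (V l ω, fun q : {q // q < t} => F q ω))
    (hV : ∀ l, Measurable (V l) := by fun_prop) (hF_meas : ∀ t, Measurable (F t) := by fun_prop) :
    condMultiInfo μ V (fun ω t => F t ω) ≤ multiInfo μ V := by
  induction r with
  | zero => exact (condMultiInfo_of_subsingleton _).le
  | succ r ih =>
    have hprefix : condMultiInfo μ V (fun ω (t : Fin r) => F t.castSucc ω) ≤ multiInfo μ V := by
      refine ih (F := fun t => F t.castSucc) (fun t => ?_) fun t => hF_meas _
      obtain ⟨l, hl⟩ := hF t.castSucc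
      refine ⟨l, fun ω ω' e => hl ?_⟩
      simp only [Prod.ext_iff, funext_iff, Subtype.forall] at e ⊢
      exact ⟨e.1, fun q hq => e.2 (q.castLT (lt_trans hq t.2)) hq⟩
    obtain ⟨l, hl⟩ := hF (Fin.last r)
    refine (condMultiInfo_le_of_message l (fun ω ω' e => ?_) fun ω ω' e => ?_).trans hprefix
    · exact funext fun t => congrFun e t.castSucc
    · simp only [Prod.ext_iff, funext_iff] at e
      refine funext (Fin.lastCases (hl ?_) e.2)
      exact Prod.ext e.1 (funext fun q => e.2 (q.1.castLT q.2))

theorem condEntropy_add_condEntropy_comm {X : Ω → T'} {K : Ω → κ} {G : Ω → T}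
    (hX : Measurable X := by fun_prop) (hK : Measurable K := by fun_prop)
    (hG : Measurable G := by fun_prop) :
    condEntropy μ X (fun ω => (K ω, G ω)) + condEntropy μ K G =
      condEntropy μ K (fun ω => (X ω, G ω)) + condEntropy μ X G := by
  rw [← condEntropy_prodMk, ← condEntropy_prodMk]
  exact (condEntropy_le_of_factorsThrough fun ω ω' e => by simp_all).antisymm
    (condEntropy_le_of_factorsThrough fun ω ω' e => by simp_all)

-- This is `0 ≤ condMultiInfo μ V (K, G)`, expanded by the chain rule.
theorem card_sub_one_mul_condEntropy_le {K : Ω → κ} {G : Ω → T}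
    (hKV : K.FactorsThrough fun ω l => V l ω) (hV : ∀ l, Measurable (V l) := by fun_prop)
    (hK : Measurable K := by fun_prop) (hG : Measurable G := by fun_prop) :
    (Fintype.card ι - 1 : ℝ) * condEntropy μ K G ≤
      condMultiInfo μ V G + ∑ l, condEntropy μ K (fun ω => (V l ω, G ω)) := by
  have hnonneg : 0 ≤ condMultiInfo μ V (fun ω => (K ω, G ω)) := condMultiInfo_nonneg _
  have hfamily : condEntropy μ (fun ω l => V l ω) (fun ω => (K ω, G ω)) =
      condEntropy μ (fun ω l => V l ω) G - condEntropy μ K G :=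
    condEntropy_eq_sub_of_factorsThrough (fun _ _ e => (Prod.ext_iff.1 e).2) fun _ _ e =>
      Prod.ext (hKV (Prod.ext_iff.1 e).1) (Prod.ext_iff.1 e).2
  have hsum : ∑ l, condEntropy μ (V l) (fun ω => (K ω, G ω)) + Fintype.card ι * condEntropy μ K G =
      ∑ l, condEntropy μ K (fun ω => (V l ω, G ω)) + ∑ l, condEntropy μ (V l) G := by
    rw [← Finset.sum_add_distrib, ← Finset.sum_congr rfl fun l _ =>
      condEntropy_add_condEntropy_comm (X := V l) (K := K) (G := G), Finset.sum_add_distrib]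
    simp
  unfold condMultiInfo at hnonneg ⊢
  linarith

end MultiInfo

section Source

variable {m n : ℕ} {κ : Type*} {𝒳 : Fin m → Type*} {u : Fin m → ℕ}

/-- The terminals of block `l`, the blocks being the fibres of `c`. -/
abbrev Block (c : Fin m → κ) (l : κ) : Type := {i : Fin m // c i = l}

/-- The private data of all the terminals of block `l`. -/
def blockView (c : Fin m → κ) (l : κ) (s : Outcome 𝒳 n u) :
    ∀ i : Block c l, Fin (u i) × (Fin n → 𝒳 i) :=
  fun i => localView (i : Fin m) s

theorem injective_blockView (c : Fin m → κ) :
    Function.Injective fun (s : Outcome 𝒳 n u) l => blockView c l s := by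
  intro s s' h
  have hview : ∀ i, localView i s = localView i s' := fun i => congrFun (congrFun h (c i)) ⟨i, rfl⟩
  exact Prod.ext (funext fun t => funext fun i => congrFun (congrArg Prod.snd (hview i)) t)
    (funext fun i => congrArg Prod.fst (hview i))

theorem IsPublicCommunication.exists_factorsThrough_blockView {r b : ℕ} {speaker : Fin r → Fin m}
    {F : Fin r → Outcome 𝒳 n u → Fin b} (hF : IsPublicCommunication speaker F) (c : Fin m → κ)
    (t : Fin r) : ∃ l, (F t).FactorsThrough
      fun s => (blockView c l s, fun q : {q // q < t} => F q s) := by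
  obtain ⟨f, hf⟩ := hF t
  refine ⟨c (speaker t), fun s s' e => ?_⟩
  have hview : localView (speaker t) s = localView (speaker t) s' :=
    congrFun (Prod.ext_iff.1 e).1 ⟨speaker t, rfl⟩
  have hpast : (fun q : {q // q < t} => F q s) = fun q : {q // q < t} => F q s' :=
    (Prod.ext_iff.1 e).2
  rw [hf, hf, hview, hpast]

variable [∀ i, MeasurableSpace (𝒳 i)] {P : Measure (∀ i, 𝒳 i)} [IsProbabilityMeasure P]
  {ν : ∀ i, Measure (Fin (u i))} [∀ i, IsProbabilityMeasure (ν i)]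

theorem measurePreserving_source (t : Fin n) :
    MeasurePreserving (fun s : Outcome 𝒳 n u => s.1 t) (outcomeLaw P n ν) P :=
  (measurePreserving_eval (fun _ : Fin n => P) t).comp measurePreserving_fst

theorem measurePreserving_randomness (i : Fin m) :
    MeasurePreserving (fun s : Outcome 𝒳 n u => s.2 i) (outcomeLaw P n ν) (ν i) :=
  (measurePreserving_eval ν i).comp measurePreserving_snd

instance : IsProbabilityMeasure (outcomeLaw P n ν) := by
  unfold outcomeLaw
  infer_instance

theorem entropy_symbolwise_le {T : Type*} [Fintype T] [MeasurableSpace T]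
    [MeasurableSingletonClass T] {h : (∀ i, 𝒳 i) → T} (hh : Measurable h := by fun_prop) :
    entropy (outcomeLaw P n ν) (fun s t => h (s.1 t)) ≤ n * entropy P h :=
  calc entropy (outcomeLaw P n ν) (fun s t => h (s.1 t))
      ≤ ∑ t, entropy (outcomeLaw P n ν) (fun s => h (s.1 t)) :=
        entropy_le_sum (X := fun t (s : Outcome 𝒳 n u) => h (s.1 t))
          fun s s' e => funext fun t => congrFun e ⟨t, Finset.mem_univ t⟩
    _ = ∑ _ : Fin n, entropy P h :=
        Finset.sum_congr rfl fun t _ => entropy_comp_measurePreserving (measurePreserving_source t)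
    _ = n * entropy P h := by simp

theorem entropy_randomness_le (p : Fin m → Prop) [DecidablePred p] :
    entropy (outcomeLaw P n ν) (fun s (i : {i // p i}) => s.2 i) ≤ ∑ i with p i, entropy (ν i) id :=
  calc entropy (outcomeLaw P n ν) (fun s (i : {i // p i}) => s.2 i)
      ≤ ∑ i with p i, entropy (outcomeLaw P n ν) (fun s => s.2 i) :=
        entropy_le_sum (X := fun i (s : Outcome 𝒳 n u) => s.2 i) fun s s' e =>
          funext fun i => congrFun e ⟨i, Finset.mem_filter.2 ⟨Finset.mem_univ _, i.2⟩⟩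
    _ = ∑ i with p i, entropy (ν i) id := Finset.sum_congr rfl fun i _ =>
        entropy_comp_measurePreserving (measurePreserving_randomness (P := P) (n := n) i) (X := id)

variable [∀ i, Fintype (𝒳 i)] [∀ i, MeasurableSingletonClass (𝒳 i)] [DecidableEq κ]

theorem entropy_outcomeLaw :
    entropy (outcomeLaw P n ν) id = n * entropy P id + ∑ i, entropy (ν i) id := by
  have hprod : entropy (outcomeLaw P n ν) id =
      entropy (outcomeLaw P n ν) Prod.fst + entropy (outcomeLaw P n ν) Prod.snd :=
    entropy_prodMk_of_indepFun (ProbabilityTheory.indepFun_prod measurable_id measurable_id)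
  have hsource : entropy (outcomeLaw P n ν) Prod.fst = n * entropy P id := by
    calc entropy (outcomeLaw P n ν) Prod.fst
        = entropy (Measure.pi fun _ : Fin n => P) id :=
          entropy_comp_measurePreserving measurePreserving_fst (X := id)
      _ = ∑ t, entropy (Measure.pi fun _ : Fin n => P) (Function.eval t) :=
          entropy_pi_of_iIndepFun (X := Function.eval)
            (ProbabilityTheory.iIndepFun_pi (X := fun _ => id) fun _ => aemeasurable_id)
      _ = ∑ _ : Fin n, entropy P id := Finset.sum_congr rfl fun t _ =>
          entropy_comp_measurePreserving (measurePreserving_eval (fun _ : Fin n => P) t) (X := id)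
      _ = n * entropy P id := by simp
  have hrandom : entropy (outcomeLaw P n ν) Prod.snd = ∑ i, entropy (ν i) id := by
    calc entropy (outcomeLaw P n ν) Prod.snd
        = entropy (Measure.pi ν) id :=
          entropy_comp_measurePreserving measurePreserving_snd (X := id)
      _ = ∑ i, entropy (Measure.pi ν) (Function.eval i) :=
          entropy_pi_of_iIndepFun (X := Function.eval)
            (ProbabilityTheory.iIndepFun_pi (X := fun _ => id) fun _ => aemeasurable_id)
      _ = ∑ i, entropy (ν i) id := Finset.sum_congr rfl fun i _ =>
          entropy_comp_measurePreserving (measurePreserving_eval ν i) (X := id)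
  rw [hprod, hsource, hrandom]

theorem entropy_blockView_le (c : Fin m → κ) (l : κ) :
    entropy (outcomeLaw P n ν) (blockView c l) ≤
      n * entropy P (fun x (i : Block c l) => x i) + ∑ i with c i = l, entropy (ν i) id := by
  have hview : (blockView c l).FactorsThrough fun s : Outcome 𝒳 n u =>
      (fun t (i : Block c l) => s.1 t i, fun i : Block c l => s.2 i) := by
    intro s s' e
    obtain ⟨hsource, hrandom⟩ := Prod.ext_iff.1 e
    exact funext fun i =>
      Prod.ext (congrFun hrandom i) (funext fun t => congrFun (congrFun hsource t) i)
  have hsource := entropy_symbolwise_le (P := P) (ν := ν) (n := n)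
    (h := fun x (i : Block c l) => x i)
  have hrandom := entropy_randomness_le (P := P) (ν := ν) (n := n) fun i => c i = l
  exact (entropy_le_add hview).trans (add_le_add hsource hrandom)

variable [Fintype κ]

/-- The multi-information, under the joint law `P`, of the blocks of terminals on which `c` is
constant. -/
noncomputable def partitionInfo (P : Measure (∀ i, 𝒳 i)) (c : Fin m → κ) : ℝ :=
  multiInfo P fun l x (i : Block c l) => x i

theorem multiInfo_blockView_le (c : Fin m → κ) :
    multiInfo (outcomeLaw P n ν) (blockView c) ≤ n * partitionInfo P c := by
  have hblocks := Finset.sum_le_sum fun l (_ : l ∈ Finset.univ) =>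
    entropy_blockView_le (P := P) (n := n) (ν := ν) c l
  rw [Finset.sum_add_distrib, ← Finset.mul_sum, Finset.sum_fiberwise] at hblocks
  have hjoint : entropy (outcomeLaw P n ν) id ≤
      entropy (outcomeLaw P n ν) fun s l => blockView c l s :=
    entropy_le_of_factorsThrough ((injective_blockView c).factorsThrough id)
  have hletter : entropy P (fun x l (i : Block c l) => x i) ≤ entropy P id :=
    entropy_le_of_factorsThrough (Function.injective_id.factorsThrough _)
  have hletter_n := mul_le_mul_of_nonneg_left hletter n.cast_nonneg
  rw [entropy_outcomeLaw] at hjoint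
  unfold multiInfo partitionInfo multiInfo
  linarith

theorem IsSecretKey.card_sub_one_mul_le {A : Finset (Fin m)} {r b N : ℕ} {speaker : Fin r → Fin m}
    {F : Fin r → Outcome 𝒳 n u → Fin b} {K : Outcome 𝒳 n u → Fin N} {ε : ℝ}
    (hK : IsSecretKey (outcomeLaw P n ν) A F K ε) (hF : IsPublicCommunication speaker F)
    {c : Fin m → κ} (hc : ∀ l, ∃ i ∈ A, c i = l) :
    (Fintype.card κ - 1 : ℝ) * (entropy (outcomeLaw P n ν) K -
        mutualInfo (outcomeLaw P n ν) K fun s t => F t s) ≤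
      n * partitionInfo P c + Fintype.card κ * (Real.log 2 + ε * Real.log N) := by
  set μ := outcomeLaw P n ν
  have hfano : ∀ l, condEntropy μ K (fun s => (blockView c l s, fun t => F t s)) ≤
      Real.log 2 + ε * Real.log N := by
    intro l
    obtain ⟨i, hi, rfl⟩ := hc l
    obtain ⟨g, hg⟩ := hK.recoverable i hi
    simpa using fano (K := K) (W := fun s => (blockView c (c i) s, fun t => F t s))
      (fun z : (∀ i : Block c (c i), _) × _ => g (z.1 ⟨i, rfl⟩) z.2) hg
  calc (Fintype.card κ - 1 : ℝ) * (entropy μ K - mutualInfo μ K fun s t => F t s)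
      = (Fintype.card κ - 1 : ℝ) * condEntropy μ K (fun s t => F t s) := by
        rw [mutualInfo_eq_entropy_sub_condEntropy, sub_sub_cancel]
    _ ≤ condMultiInfo μ (blockView c) (fun s t => F t s) +
          ∑ l, condEntropy μ K (fun s => (blockView c l s, fun t => F t s)) :=
        card_sub_one_mul_condEntropy_le ((injective_blockView c).factorsThrough K)
    _ ≤ multiInfo μ (blockView c) + ∑ _ : κ, (Real.log 2 + ε * Real.log N) :=
        add_le_add (condMultiInfo_communication_le (hF.exists_factorsThrough_blockView c))
          (Finset.sum_le_sum fun l _ => hfano l)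
    _ ≤ n * partitionInfo P c + Fintype.card κ * (Real.log 2 + ε * Real.log N) := by
        rw [Finset.sum_const, nsmul_eq_mul, Finset.card_univ]
        gcongr
        exact multiInfo_blockView_le c

theorem IsAchievable.sub_mul_le {A : Finset (Fin m)} {R : ℝ} (hR : IsAchievable P A R)
    [Nontrivial κ] {c : Fin m → κ} (hc : ∀ l, ∃ i ∈ A, c i = l) {ε : ℝ} (hε : 0 < ε)
    (hε' : ε < 1 / 2) :
    (R - ε) * (Fintype.card κ - 1 - Fintype.card κ * ε) ≤
      partitionInfo P c + (Fintype.card κ - 1) * ε + Fintype.card κ * (ε + ε * ε) := by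
  have hcard : (2 : ℝ) ≤ Fintype.card κ := by exact_mod_cast Fintype.one_lt_card (α := κ)
  obtain ⟨n₀, hn₀⟩ := hR ε hε
  obtain ⟨n₁, hn₁⟩ := exists_nat_gt (Real.log 2 / ε)
  set n := max n₀ n₁
  obtain ⟨u, ν, r, b, N, speaker, F, K, hν, hF, hK, hrate⟩ := hn₀ n (le_max_left _ _)
  have hn : Real.log 2 / ε < n := hn₁.trans_le (by exact_mod_cast le_max_right _ _)
  have hn_pos : (0 : ℝ) < n := (div_pos (Real.log_pos one_lt_two) hε).trans hn
  have hlog : Real.log 2 ≤ n * ε := ((div_lt_iff₀ hε).1 hn).le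
  rw [le_div_iff₀ hn_pos] at hrate
  set H := entropy (outcomeLaw P n ν) K
  have hnonneg : 0 ≤ (Fintype.card κ - 1 - Fintype.card κ * ε : ℝ) := by nlinarith
  have hentropy : (Fintype.card κ - 1 : ℝ) * (H - n * ε) ≤
      n * partitionInfo P c + Fintype.card κ * (n * ε + ε * (H + n * ε)) :=
    calc (Fintype.card κ - 1 : ℝ) * (H - n * ε)
        ≤ (Fintype.card κ - 1 : ℝ) * (H - mutualInfo _ K fun s t => F t s) :=
          mul_le_mul_of_nonneg_left (sub_le_sub_left hK.secret _) (by linarith)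
      _ ≤ n * partitionInfo P c + Fintype.card κ * (Real.log 2 + ε * Real.log N) :=
          hK.card_sub_one_mul_le hF hc
      _ ≤ n * partitionInfo P c + Fintype.card κ * (n * ε + ε * (H + n * ε)) := by
          gcongr
          linarith [hK.uniform]
  refine le_of_mul_le_mul_left ?_ hn_pos
  linarith [mul_le_mul_of_nonneg_right hrate hnonneg]

theorem IsAchievable.mul_le_partitionInfo {A : Finset (Fin m)} {R : ℝ} (hR : IsAchievable P A R)
    [Nontrivial κ] {c : Fin m → κ} (hc : ∀ l, ∃ i ∈ A, c i = l) :
    R * (Fintype.card κ - 1) ≤ partitionInfo P c := by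
  have hleft : Filter.Tendsto (fun ε : ℝ => (R - ε) * (Fintype.card κ - 1 - Fintype.card κ * ε))
      (nhdsWithin 0 (Set.Ioi 0)) (nhds (R * (Fintype.card κ - 1))) :=
    (Continuous.tendsto' (by fun_prop) 0 _ (by simp)).mono_left nhdsWithin_le_nhds
  have hright : Filter.Tendsto (fun ε : ℝ => partitionInfo P c + (Fintype.card κ - 1) * ε +
      Fintype.card κ * (ε + ε * ε)) (nhdsWithin 0 (Set.Ioi 0)) (nhds (partitionInfo P c)) :=
    (Continuous.tendsto' (by fun_prop) 0 _ (by simp)).mono_left nhdsWithin_le_nhds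
  refine le_of_tendsto_of_tendsto hleft hright ?_
  filter_upwards [Ioo_mem_nhdsGT (one_half_pos (α := ℝ))] with ε hε
  exact hR.sub_mul_le hc hε.1 hε.2

end Source

section Network

theorem sum_filter_ne_eq_sum_filter_lt {ι κ M : Type*} [Fintype ι] [LinearOrder κ]
    [AddCommMonoid M] (c : ι → κ) (f : ι × ι → M) :
    ∑ p with c p.1 ≠ c p.2, f p = ∑ p : ι × ι with c p.1 < c p.2, (f p + f p.swap) := by
  classical
  have hswap : ∑ p : ι × ι with c p.2 < c p.1, f p = ∑ p : ι × ι with c p.1 < c p.2, f p.swap :=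
    Finset.sum_equiv (Equiv.prodComm ι ι) (by simp) (by simp)
  have hdisj : Disjoint (Finset.univ.filter fun p : ι × ι => c p.1 < c p.2)
      (Finset.univ.filter fun p => c p.2 < c p.1) :=
    Finset.disjoint_filter.2 fun _ _ h => h.not_gt
  simp only [ne_iff_lt_or_gt, Finset.filter_or]
  rw [Finset.sum_union hdisj, hswap, Finset.sum_add_distrib]

variable {m k : ℕ} {𝒴 : Fin m → Fin m → Type*} {Ω : Type*} [MeasurableSpace Ω] {μ : Measure Ω}
  {Y : ∀ i j, Ω → 𝒴 i j}

theorem crossInfo_fibers [∀ i j, Fintype (𝒴 i j)] (c : Fin m → Fin k) :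
    crossInfo μ Y (fun l => Finset.univ.filter fun i => c i = l) =
      ∑ p : Fin m × Fin m with c p.1 < c p.2, mutualInfo μ (Y p.1 p.2) (Y p.2 p.1) := by
  have hrow : ∀ l, ∀ i ∈ Finset.univ.filter (c · = l),
      ∑ r with l < r, ∑ j with c j = r, mutualInfo μ (Y i j) (Y j i) =
        ∑ j with c i < c j, mutualInfo μ (Y i j) (Y j i) := by
    intro l i hi
    rw [Finset.sum_fiberwise_eq_sum_filter, ← (Finset.mem_filter.1 hi).2]
    simp only [Finset.mem_filter_univ]
  calc crossInfo μ Y (fun l => Finset.univ.filter fun i => c i = l)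
      = ∑ l, ∑ i with c i = l, ∑ r with l < r, ∑ j with c j = r, mutualInfo μ (Y i j) (Y j i) :=
        Finset.sum_congr rfl fun l _ => Finset.sum_comm
    _ = ∑ l, ∑ i with c i = l, ∑ j with c i < c j, mutualInfo μ (Y i j) (Y j i) :=
        Finset.sum_congr rfl fun l _ => Finset.sum_congr rfl (hrow l)
    _ = ∑ i, ∑ j with c i < c j, mutualInfo μ (Y i j) (Y j i) := Finset.sum_fiberwise _ _ _
    _ = ∑ p : Fin m × Fin m with c p.1 < c p.2, mutualInfo μ (Y p.1 p.2) (Y p.2 p.1) := by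
        simp only [Finset.sum_filter, Fintype.sum_prod_type]

variable [∀ i j, MeasurableSpace (𝒴 i j)]

theorem measurePreserving_network (hY : ∀ i j, Measurable (Y i j)) :
    MeasurePreserving (fun ω i (j : {j : Fin m // j ≠ i}) => Y i j ω) μ (networkLaw μ Y) :=
  ⟨by fun_prop, rfl⟩

theorem isProbabilityMeasure_networkLaw [IsProbabilityMeasure μ] (hY : ∀ i j, Measurable (Y i j)) :
    IsProbabilityMeasure (networkLaw μ Y) :=
  Measure.isProbabilityMeasure_map (measurePreserving_network hY).aemeasurable

variable [∀ i j, Fintype (𝒴 i j)] [∀ i j, MeasurableSingletonClass (𝒴 i j)]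

theorem partitionInfo_networkLaw (hY : ∀ i j, Measurable (Y i j)) (c : Fin m → Fin k) :
    partitionInfo (networkLaw μ Y) c =
      multiInfo μ fun l ω (i : Block c l) (j : {j : Fin m // j ≠ i}) => Y i j ω :=
  (multiInfo_comp_measurePreserving (measurePreserving_network hY)
    (V := fun l x (i : Block c l) => x i)).symm

variable [IsProbabilityMeasure μ]

theorem IsPairwiseIndependent.sum_entropy_le {R : Type*} [Fintype R] [MeasurableSpace R]
    [MeasurableSingletonClass R] (hind : IsPairwiseIndependent μ Y) {Z : Ω → R}
    {s : Finset (Fin m × Fin m)} (hs : ∀ p ∈ s, ∀ q ∈ s, q ≠ p.swap)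
    (hYZ : ∀ i j, i ≠ j → (Y i j).FactorsThrough Z)
    (hY : ∀ i j, Measurable (Y i j)) (hZ : Measurable Z := by fun_prop) :
    ∑ p ∈ s, entropy μ (fun ω => (Y p.1 p.2 ω, Y p.2 p.1 ω)) ≤ entropy μ Z := by
  have hne : ∀ p ∈ s, p.1 ≠ p.2 := fun p hp h => hs p hp p hp (Prod.ext h h.symm)
  refine sum_entropy_le_of_mutualInfo_eq_zero s (fun p hp q hq hqp ω ω' e => ?_)
    (fun p hp => hind p.1 p.2 (hne p hp)) fun p hp ω ω' e =>
      Prod.ext (hYZ _ _ (hne p hp) e) (hYZ _ _ (hne p hp).symm e)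
  have hqp_swap : q.swap ≠ p := fun h => hs q hq p hp h.symm
  exact Prod.ext (congrFun e ⟨q, hne q hq, hqp, hs p hp q hq⟩)
    (congrFun e ⟨q.swap, (hne q hq).symm, hqp_swap, fun h => hqp (Prod.swap_injective h)⟩)

theorem entropy_block_le (hY : ∀ i j, Measurable (Y i j)) (c : Fin m → Fin k) (l : Fin k) :
    entropy μ (fun ω (i : Block c l) (j : {j : Fin m // j ≠ i}) => Y i j ω) ≤
      ∑ p : Fin m × Fin m with (c p.1 = c p.2 ∧ p.1 < p.2) ∧ c p.1 = l,
          entropy μ (fun ω => (Y p.1 p.2 ω, Y p.2 p.1 ω)) +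
        ∑ p : Fin m × Fin m with c p.1 ≠ c p.2 ∧ c p.1 = l, entropy μ (Y p.1 p.2) := by
  let inside := Finset.univ.filter fun p : Fin m × Fin m => (c p.1 = c p.2 ∧ p.1 < p.2) ∧ c p.1 = l
  let outgoing := Finset.univ.filter fun p : Fin m × Fin m => c p.1 ≠ c p.2 ∧ c p.1 = l
  have hdetermined : (fun ω (i : Block c l) (j : {j : Fin m // j ≠ i}) => Y i j ω).FactorsThrough
      fun ω => (fun p : inside => (Y p.1.1 p.1.2 ω, Y p.1.2 p.1.1 ω),
        fun p : outgoing => Y p.1.1 p.1.2 ω) := by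
    intro ω ω' e
    obtain ⟨hinside, houtgoing⟩ := Prod.ext_iff.1 e
    funext ⟨i, hi⟩ ⟨j, hj⟩
    by_cases hij : c i = c j
    · rcases lt_or_gt_of_ne hj with h | h
      · exact (Prod.ext_iff.1 (congrFun hinside ⟨(j, i), by simp [inside, h, hij.symm, hi]⟩)).2
      · exact (Prod.ext_iff.1 (congrFun hinside ⟨(i, j), by simp [inside, h, hij, ← hi]⟩)).1
    · exact congrFun houtgoing ⟨(i, j), by simp [outgoing, hij, ← hi]⟩
  exact (entropy_le_add hdetermined).trans
    (add_le_add (entropy_le_sum fun _ _ e => e) (entropy_le_sum fun _ _ e => e))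

theorem sum_entropy_block_le (hY : ∀ i j, Measurable (Y i j)) (c : Fin m → Fin k) :
    ∑ l, entropy μ (fun ω (i : Block c l) (j : {j : Fin m // j ≠ i}) => Y i j ω) ≤
      ∑ p : Fin m × Fin m with c p.1 = c p.2 ∧ p.1 < p.2,
          entropy μ (fun ω => (Y p.1 p.2 ω, Y p.2 p.1 ω)) +
        ∑ p : Fin m × Fin m with c p.1 < c p.2,
          (entropy μ (Y p.1 p.2) + entropy μ (Y p.2 p.1)) := by
  refine (Finset.sum_le_sum fun l _ => entropy_block_le hY c l).trans_eq ?_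
  simp only [Finset.sum_add_distrib, ← Finset.filter_filter]
  rw [Finset.sum_fiberwise, Finset.sum_fiberwise,
    sum_filter_ne_eq_sum_filter_lt c fun p => entropy μ (Y p.1 p.2)]
  simp only [Prod.fst_swap, Prod.snd_swap, Finset.sum_add_distrib]

theorem IsPairwiseIndependent.partitionInfo_le_crossInfo (hind : IsPairwiseIndependent μ Y)
    (hY : ∀ i j, Measurable (Y i j)) (c : Fin m → Fin k) :
    partitionInfo (networkLaw μ Y) c ≤
      crossInfo μ Y (fun l => Finset.univ.filter fun i => c i = l) := by
  let inside := Finset.univ.filter fun p : Fin m × Fin m => c p.1 = c p.2 ∧ p.1 < p.2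
  let cross := Finset.univ.filter fun p : Fin m × Fin m => c p.1 < c p.2
  let H : Fin m × Fin m → ℝ := fun p => entropy μ (fun ω => (Y p.1 p.2 ω, Y p.2 p.1 ω))
  have hdisj : Disjoint inside cross := Finset.disjoint_filter.2 fun p _ h => h.1.not_lt
  have hjoint : ∑ p ∈ inside, H p + ∑ p ∈ cross, H p ≤
      entropy μ (fun ω l (i : Block c l) (j : {j : Fin m // j ≠ i}) => Y i j ω) := by
    rw [← Finset.sum_union hdisj]
    refine hind.sum_entropy_le (fun p hp q hq hqp => ?_) (fun i j hij ω ω' e => ?_) hY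
    · subst hqp
      simp only [inside, cross, Finset.mem_union, Finset.mem_filter_univ, Prod.fst_swap,
        Prod.snd_swap] at hp hq
      grind
    · exact congrFun (congrFun (congrFun e (c i)) ⟨i, rfl⟩) ⟨j, hij.symm⟩
  have hblocks := sum_entropy_block_le (μ := μ) hY c
  rw [partitionInfo_networkLaw hY, crossInfo_fibers]
  simp only [multiInfo, mutualInfo, Finset.sum_sub_distrib]
  linarith

end Network

section Partitions

variable {m k : ℕ} {A : Finset (Fin m)}

theorem IsKPartition.exists_eq_fibers {B : Fin k → Finset (Fin m)} (hB : IsKPartition A B) :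
    ∃ c : Fin m → Fin k, (∀ l, ∃ i ∈ A, c i = l) ∧
      B = fun l => Finset.univ.filter fun i => c i = l := by
  choose c hc using hB.cover
  have hmem : ∀ i l, i ∈ B l ↔ c i = l := fun i l =>
    ⟨fun h => by_contra fun hne => Finset.disjoint_left.1 (hB.disjoint _ _ hne) (hc i) h,
      fun h => h ▸ hc i⟩
  refine ⟨c, fun l => ?_, ?_⟩
  · obtain ⟨i, hi⟩ := hB.meets l
    rw [Finset.mem_inter, hmem] at hi
    exact ⟨i, hi.2, hi.1⟩
  · ext l i
    simp [hmem]

theorem isKPartition_fibers {c : Fin m → Fin k} (hc : ∀ l, ∃ i ∈ A, c i = l) :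
    IsKPartition A fun l => Finset.univ.filter fun i => c i = l where
  disjoint l r hlr := Finset.disjoint_filter.2 fun i _ hl hr => hlr (hl.symm.trans hr)
  cover i := ⟨c i, by simp⟩
  meets l := by
    obtain ⟨i, hi, hil⟩ := hc l
    exact ⟨i, by simp [hi, hil]⟩

theorem exists_isKPartition (hk : 1 ≤ k) (hkA : k ≤ A.card) :
    ∃ B : Fin k → Finset (Fin m), IsKPartition A B := by
  have : Nonempty (Fin k) := ⟨⟨0, hk⟩⟩
  obtain ⟨e⟩ : Nonempty (Fin k ↪ A) := Function.Embedding.nonempty_of_card_le (by simpa using hkA)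
  have he : Function.Injective fun l => (e l : Fin m) := Subtype.val_injective.comp e.injective
  exact ⟨_, isKPartition_fibers fun l => ⟨e l, (e l).2, Function.leftInverse_invFun he l⟩⟩

end Partitions

end SecretKey

theorem lemma1 {m : ℕ} {Ω : Type*} [MeasurableSpace Ω] (μ : Measure Ω) [IsProbabilityMeasure μ]
    {𝒴 : Fin m → Fin m → Type*} [∀ i j, Fintype (𝒴 i j)] [∀ i j, MeasurableSpace (𝒴 i j)]
    [∀ i j, MeasurableSingletonClass (𝒴 i j)]
    (Y : ∀ i j, Ω → 𝒴 i j) (hY : ∀ i j, Measurable (Y i j))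
    (hind : SecretKey.IsPairwiseIndependent μ Y)
    (A : Finset (Fin m)) (hA : 2 ≤ A.card) :
    SecretKey.capacity (SecretKey.networkLaw μ Y) A ≤
      ((SecretKey.partitionBound μ Y A : ℝ) : EReal) := by
  have := SecretKey.isProbabilityMeasure_networkLaw (μ := μ) hY
  refine iSup₂_le fun R hR => EReal.coe_le_coe_iff.2 (le_csInf ⟨_, 2, le_rfl, hA, rfl⟩ ?_)
  rintro v ⟨k, hk, hkA, rfl⟩
  have hk' : (2 : ℝ) ≤ k := by exact_mod_cast hk
  have : Nontrivial (Fin k) := Fin.nontrivial_iff_two_le.2 hk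
  rw [le_div_iff₀ (by linarith)]
  obtain ⟨B₀, hB₀⟩ := SecretKey.exists_isKPartition (A := A) (by omega : 1 ≤ k) hkA
  refine le_csInf ⟨_, B₀, hB₀, rfl⟩ ?_
  rintro v ⟨B, hB, rfl⟩
  obtain ⟨c, hc, rfl⟩ := hB.exists_eq_fibers
  have hrate := hR.mul_le_partitionInfo hc
  rw [Fintype.card_fin] at hrate
  exact hrate.trans (hind.partitionInfo_le_crossInfo hY c)
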